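/- Let $n\ge 1$, and let $K,L\subset\mathbb R^n$ be closed convex sets with cross covariogram $g(x):=|K\cap(L+x)|$, where $|\cdot|$ is Lebesgue measure, and assume that $0<g(b)<\infty$ for some $b\in\mathbb R^n$ (it follows that $g$ is finite everywhere). Let $a,w\in\mathbb R^n$ with $w\neq 0$. If there exists a constant $\beta\neq 0$ such that $$g(a+tw)^{1/n}=g(a)^{1/n}+t\beta\qquad(-1\le t\le 1),$$ then there exist $v\in\mathbb R^n$ and $\lambda\in\mathbb R$, with $\lambda\in(0,1]$ if $\beta>0$ and $\lambda\in[-1,0)$ if $\beta<0$, such that for all $t\in[-1,1]$ $$K\cap(L+a+tw)=K''\cap(L''+tw).$$ Here $$K'':=\left\{-\tfrac1\lambda v+s\left(x+\tfrac1\lambda v\right)\;\middle|\;x\in K,\ s\ge 0\right\},$$ $$L'':=\left\{-\tfrac1\lambda(v-w)+s\left(x+\tfrac1\lambda(v-w)\right)\;\middle|\;x\in L+a,\ s\ge 0\right\}$$ are the convex cones with vertices $-\frac1\lambda v$ and $-\frac1\lambda(v-w)$ generated by $K$ and $L+a$, respectively. -/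

import Mathlib

open scoped ENNReal

/-- The translate `A + x` of a set `A ⊆ ℝⁿ` by a vector `x`. -/
def translateBy {n : ℕ} (A : Set (EuclideanSpace ℝ (Fin n))) (x : EuclideanSpace ℝ (Fin n)) :
    Set (EuclideanSpace ℝ (Fin n)) :=
  (fun y => y + x) '' A

/-- The cross covariogram `g_{K,L}(x) = |K ∩ (L + x)|`, with `|·|` the Lebesgue measure on `ℝⁿ`;
the value may be `∞`. -/
noncomputable def crossCovariogram {n : ℕ} (K L : Set (EuclideanSpace ℝ (Fin n)))
    (x : EuclideanSpace ℝ (Fin n)) : ℝ≥0∞ :=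
  MeasureTheory.volume (K ∩ translateBy L x)

/-- The cone with vertex `p` generated by `A`: all points `p + t (x - p)` with `x ∈ A`, `t ≥ 0`. -/
def coneFrom {n : ℕ} (p : EuclideanSpace ℝ (Fin n)) (A : Set (EuclideanSpace ℝ (Fin n))) :
    Set (EuclideanSpace ℝ (Fin n)) :=
  {y | ∃ x ∈ A, ∃ t : ℝ, 0 ≤ t ∧ y = p + t • (x - p)}

/-! ### The Prékopa–Leindler inequality. -/

section PrekopaLeindler

open MeasureTheory Set

/-! The sections `C t = K ∩ (L + a + t w)` have a closed convex graph, and the n-th roots of their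
volumes are affine in `t`: this is equality in Brunn–Minkowski. So each section is homothetic to `C
0`. Convexity and boundedness make the translation part linear in `t`, whence `C t = (1 + λt) C 0 +
t v` with `λ = β / g(a)^{1/n}` (`exists_homothetic_family`). With the origin at `-v/λ`, the fixed
point of all these maps, the sections become pure dilates. Hence every point of `C 0` can be moved
slightly along its rays from both vertices without leaving `K` or `L + a`. Such freedom lets a
segment towards any point of both cones continue inside the intersection to its end
(`mem_of_mem_cones`).

The equality case comes from applying Prékopa–Leindler to exponential weights on bodies of volume 1
and expanding at parameter 0. First and second derivatives compare means and variances; a quadratic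
test function perturbed by a Lipschitz one then forces the bodies to be translates
(`exists_translate_eq_of_volume_eq_one`). -/

theorem volume_add_volume_le_of_isCompact {A B D : Set ℝ} (hA : IsCompact A) (hB : IsCompact B)
    (hA' : A.Nonempty) (hB' : B.Nonempty) (h : ∀ x ∈ A, ∀ y ∈ B, x + y ∈ D) :
    volume A + volume B ≤ volume D := by
  have hsA := hA.sSup_mem hA'
  have hiB := hB.sInf_mem hB'
  set a := sSup A
  set b := sInf B
  -- `A + inf B` and `sup A + B` both lie in `D` and share at most the point `a + b`.
  have h1 : volume ((fun x => x + -b) ⁻¹' A) = volume A := measure_preimage_add_right _ _ _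
  have h2 : volume ((fun x => x + -a) ⁻¹' B) = volume B := measure_preimage_add_right _ _ _
  rw [← h1, ← h2, ← measure_union₀]
  · apply measure_mono
    rintro x (hx | hx)
    · simpa using h _ hx _ hiB
    · simpa using h _ hsA _ hx
  · exact (hB.measurableSet.preimage (measurable_id.add_const _)).nullMeasurableSet
  · refine measure_mono_null (t := {a + b}) ?_ (by simp)
    rintro x ⟨hx, hy⟩
    have e1 : x + -b ≤ a := le_csSup hA.bddAbove hx
    have e2 : b ≤ x + -a := csInf_le hB.bddBelow hy
    simp only [mem_singleton_iff]
    linarith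

theorem volume_add_volume_le {A B D : Set ℝ} (hA : MeasurableSet A) (hB : MeasurableSet B)
    (hA' : A.Nonempty) (hB' : B.Nonempty) (h : ∀ x ∈ A, ∀ y ∈ B, x + y ∈ D) :
    volume A + volume B ≤ volume D := by
  obtain ⟨a, ha⟩ := hA'
  obtain ⟨b, hb⟩ := hB'
  -- The alternative `r = 0` covers null sets, where a singleton replaces the inner compact
  -- approximation.
  have key : ∀ r s : ℝ≥0∞, (r < volume A ∨ r = 0) → (s < volume B ∨ s = 0) →
      r + s ≤ volume D := by
    intro r s hr hs
    have eA : ∃ K ⊆ A, IsCompact K ∧ K.Nonempty ∧ r ≤ volume K := by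
      rcases hr with hr | rfl
      · obtain ⟨K, hK, hKc, hKr⟩ := hA.exists_lt_isCompact hr
        exact ⟨K, hK, hKc, nonempty_of_measure_ne_zero (zero_le.trans_lt hKr).ne', hKr.le⟩
      · exact ⟨{a}, by simpa using ha, isCompact_singleton, singleton_nonempty _, zero_le⟩
    have eB : ∃ K ⊆ B, IsCompact K ∧ K.Nonempty ∧ s ≤ volume K := by
      rcases hs with hr | rfl
      · obtain ⟨K, hK, hKc, hKr⟩ := hB.exists_lt_isCompact hr
        exact ⟨K, hK, hKc, nonempty_of_measure_ne_zero (zero_le.trans_lt hKr).ne', hKr.le⟩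
      · exact ⟨{b}, by simpa using hb, isCompact_singleton, singleton_nonempty _, zero_le⟩
    obtain ⟨P, hP, hPc, hPn, hPr⟩ := eA
    obtain ⟨Q, hQ, hQc, hQn, hQr⟩ := eB
    exact (add_le_add hPr hQr).trans
      (volume_add_volume_le_of_isCompact hPc hQc hPn hQn fun x hx y hy => h x (hP hx) y (hQ hy))
  have step : ∀ s : ℝ≥0∞, (s < volume B ∨ s = 0) → volume A + s ≤ volume D := by
    intro s hs
    by_cases h0 : volume A = 0
    · rw [h0]; exact key _ _ (Or.inr rfl) hs
    · have : Nonempty (Iio (volume A)) := ⟨⟨0, pos_iff_ne_zero.2 h0⟩⟩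
      have e : volume A = ⨆ r : Iio (volume A), (r : ℝ≥0∞) :=
        le_antisymm (le_of_forall_lt_imp_le_of_dense fun r hr =>
          le_iSup (fun r : Iio (volume A) => (r : ℝ≥0∞)) ⟨r, hr⟩) (iSup_le fun r => r.2.le)
      rw [e, ENNReal.iSup_add]
      exact iSup_le fun r => key _ _ (Or.inl r.2) hs
  by_cases h0 : volume B = 0
  · rw [h0]; exact step _ (Or.inr rfl)
  · have : Nonempty (Iio (volume B)) := ⟨⟨0, pos_iff_ne_zero.2 h0⟩⟩
    have e : volume B = ⨆ r : Iio (volume B), (r : ℝ≥0∞) :=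
      le_antisymm (le_of_forall_lt_imp_le_of_dense fun r hr =>
        le_iSup (fun r : Iio (volume B) => (r : ℝ≥0∞)) ⟨r, hr⟩) (iSup_le fun r => r.2.le)
    rw [e, ENNReal.add_iSup]
    exact iSup_le fun r => step _ (Or.inl r.2)

theorem ENNReal.geom_mean_le_arith_mean_two {l m : ℝ} (hl : 0 < l) (hm : 0 < m) (hlm : l + m = 1)
    (a b : ℝ≥0∞) : a ^ l * b ^ m ≤ ENNReal.ofReal l * a + ENNReal.ofReal m * b := by
  rcases eq_or_ne a ∞ with rfl | ha
  · simp [ENNReal.mul_top, hl]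
  rcases eq_or_ne b ∞ with rfl | hb
  · simp [ENNReal.mul_top, hm]
  lift a to NNReal using ha
  lift b to NNReal using hb
  lift l to NNReal using hl.le
  lift m to NNReal using hm.le
  have := NNReal.geom_mean_le_arith_mean2_weighted l m a b (by exact_mod_cast hlm)
  simp only [ENNReal.ofReal_coe_nnreal]
  rw [← ENNReal.coe_rpow_of_nonneg a (NNReal.coe_nonneg l),
    ← ENNReal.coe_rpow_of_nonneg b (NNReal.coe_nonneg m)]
  exact_mod_cast this

theorem lintegral_eq_lintegral_volume_lt_of_le_one {f : ℝ → ℝ≥0∞} (hf : Measurable f)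
    (h1 : ∀ x, f x ≤ 1) :
    ∫⁻ x, f x = ∫⁻ t in Ioo (0 : ℝ) 1, volume {x | ENNReal.ofReal t < f x} := by
  have hfin : ∀ x, f x ≠ ∞ := fun x => ((h1 x).trans_lt ENNReal.one_lt_top).ne
  have e := lintegral_eq_lintegral_meas_lt (volume : Measure ℝ) (f := fun x => (f x).toReal)
    (Filter.Eventually.of_forall fun x => ENNReal.toReal_nonneg) hf.ennreal_toReal.aemeasurable
  simp only [ENNReal.ofReal_toReal (hfin _)] at e
  rw [e, ← Ioo_union_Ici_eq_Ioi (zero_lt_one' ℝ), lintegral_union measurableSet_Ici]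
  · have z : ∫⁻ t in Ici (1 : ℝ), volume {a | t < (f a).toReal} = 0 := by
      rw [setLIntegral_congr_fun (g := fun _ => 0) measurableSet_Ici]
      · simp
      · intro t ht
        have : {a | t < (f a).toReal} = ∅ := by
          ext x
          simp only [mem_ofPred_eq, mem_empty_iff_false, iff_false, not_lt]
          exact (ENNReal.toReal_mono ENNReal.one_ne_top (h1 x)).trans (by simpa using ht)
        simp [this]
    rw [z, add_zero]
    refine setLIntegral_congr_fun measurableSet_Ioo fun t ht => ?_
    congr 1
    ext x
    exact (ENNReal.ofReal_lt_iff_lt_toReal ht.1.le (hfin x)).symm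
  · exact disjoint_left.2 fun x hx hy => absurd hx.2 (not_lt.2 hy)

/-- Prékopa–Leindler on the line for functions with supremum `1`, with the arithmetic mean. -/
theorem arith_mean_lintegral_le_of_iSup_eq_one {f g h : ℝ → ℝ≥0∞} (hf : Measurable f)
    (hg : Measurable g) (hh : Measurable h) {l m : ℝ} (hl : 0 < l) (hm : 0 < m) (hlm : l + m = 1)
    (hf1 : ⨆ x, f x = 1) (hg1 : ⨆ x, g x = 1)
    (H : ∀ x y, f x ^ l * g y ^ m ≤ h (l * x + m * y)) :
    ENNReal.ofReal l * (∫⁻ x, f x) + ENNReal.ofReal m * (∫⁻ x, g x) ≤ ∫⁻ x, h x := by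
  have hscale : ∀ (c : ℝ) (hc : 0 < c) (S : Set ℝ),
      ENNReal.ofReal c * volume S = volume ((fun x => c⁻¹ * x) ⁻¹' S) := by
    intro c hc S
    rw [Real.volume_preimage_mul_left (inv_ne_zero hc.ne'), inv_inv, abs_of_pos hc]
  -- Once `h` is cut at 1, all level sets are indexed by (0,1). There those of `f` and `g` are
  -- nonempty, as the one-dimensional sumset bound requires.
  have hmin : ∫⁻ x, min (h x) 1 ≤ ∫⁻ x, h x := lintegral_mono fun x => min_le_left _ _
  refine le_trans ?_ hmin
  rw [lintegral_eq_lintegral_volume_lt_of_le_one hf fun x => (le_iSup f x).trans hf1.le,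
    lintegral_eq_lintegral_volume_lt_of_le_one hg fun x => (le_iSup g x).trans hg1.le,
    lintegral_eq_lintegral_volume_lt_of_le_one (hh.min measurable_const) fun x => min_le_right _ _,
    ← lintegral_const_mul' _ _ ENNReal.ofReal_ne_top,
    ← lintegral_const_mul' _ _ ENNReal.ofReal_ne_top]
  rw [← lintegral_add_left']
  · refine setLIntegral_mono' measurableSet_Ioo fun t ht => ?_
    rw [hscale l hl, hscale m hm]
    have ht1 : ENNReal.ofReal t < 1 := by simpa using ht.2
    apply volume_add_volume_le
    · exact (measurableSet_lt measurable_const hf).preimage (measurable_const_mul _)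
    · exact (measurableSet_lt measurable_const hg).preimage (measurable_const_mul _)
    · obtain ⟨x, hx⟩ := lt_iSup_iff.1 (hf1 ▸ ht1)
      exact ⟨l * x, by simpa [hl.ne'] using hx⟩
    · obtain ⟨x, hx⟩ := lt_iSup_iff.1 (hg1 ▸ ht1)
      exact ⟨m * x, by simpa [hm.ne'] using hx⟩
    · intro x hx y hy
      simp only [mem_preimage, mem_ofPred_eq] at hx hy
      have e := H (l⁻¹ * x) (m⁻¹ * y)
      rw [mul_inv_cancel_left₀ hl.ne', mul_inv_cancel_left₀ hm.ne'] at e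
      refine lt_min (lt_of_lt_of_le ?_ e) ht1
      have : ENNReal.ofReal t = ENNReal.ofReal t ^ l * ENNReal.ofReal t ^ m := by
        rw [← ENNReal.rpow_add _ _ (by simpa using ht.1) ENNReal.ofReal_ne_top, hlm,
          ENNReal.rpow_one]
      rw [this]
      exact ENNReal.mul_lt_mul (ENNReal.rpow_lt_rpow hx hl) (ENNReal.rpow_lt_rpow hy hm)
  · refine (Antitone.measurable ?_).aemeasurable.const_mul _
    intro s t hst
    exact measure_mono fun x hx => lt_of_le_of_lt (ENNReal.ofReal_le_ofReal hst) hx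

/-- Dividing by the suprema reduces to the arithmetic-mean form; the weighted AM–GM inequality
returns to the geometric mean, and the scale factors cancel. -/
theorem prekopa_leindler_real_of_bounded {f g h : ℝ → ℝ≥0∞} (hf : Measurable f)
    (hg : Measurable g) (hh : Measurable h) {l m : ℝ} (hl : 0 < l) (hm : 0 < m) (hlm : l + m = 1)
    (hf1 : ⨆ x, f x ≠ ∞) (hg1 : ⨆ x, g x ≠ ∞)
    (H : ∀ x y, f x ^ l * g y ^ m ≤ h (l * x + m * y)) :
    (∫⁻ x, f x) ^ l * (∫⁻ x, g x) ^ m ≤ ∫⁻ x, h x := by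
  set S := ⨆ x, f x with hS
  set T := ⨆ x, g x with hT
  by_cases hS0 : S = 0
  · have : ∀ x, f x = 0 := fun x => le_antisymm ((le_iSup f x).trans hS0.le) zero_le
    simp [this, hl]
  by_cases hT0 : T = 0
  · have : ∀ x, g x = 0 := fun x => le_antisymm ((le_iSup g x).trans hT0.le) zero_le
    simp [this, hm]
  have key := arith_mean_lintegral_le_of_iSup_eq_one (f := fun x => S⁻¹ * f x)
    (g := fun x => T⁻¹ * g x) (h := fun x => (S⁻¹ ^ l * T⁻¹ ^ m) * h x)
    (hf.const_mul _) (hg.const_mul _) (hh.const_mul _) hl hm hlm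
    (by rw [← ENNReal.mul_iSup, ← hS, ENNReal.inv_mul_cancel hS0 hf1])
    (by rw [← ENNReal.mul_iSup, ← hT, ENNReal.inv_mul_cancel hT0 hg1])
    (fun x y => by
      rw [ENNReal.mul_rpow_of_nonneg _ _ hl.le, ENNReal.mul_rpow_of_nonneg _ _ hm.le,
        mul_mul_mul_comm]
      gcongr
      exact H x y)
  have key2 := (ENNReal.geom_mean_le_arith_mean_two hl hm hlm _ _).trans key
  simp only [lintegral_const_mul _ hf, lintegral_const_mul _ hg, lintegral_const_mul _ hh] at key2
  rw [ENNReal.mul_rpow_of_nonneg _ _ hl.le, ENNReal.mul_rpow_of_nonneg _ _ hm.le,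
    mul_mul_mul_comm] at key2
  refine (ENNReal.mul_le_mul_iff_right ?_ ?_).1 key2
  · refine mul_ne_zero ?_ ?_ <;> simp [ENNReal.rpow_eq_zero_iff, hS0, hT0, hf1, hg1]
  · refine ENNReal.mul_ne_top ?_ ?_ <;> apply ENNReal.rpow_ne_top_of_nonneg <;>
      simp [hS0, hT0, hl.le, hm.le]

theorem prekopa_leindler_real {f g h : ℝ → ℝ≥0∞} (hf : Measurable f)
    (hg : Measurable g) (hh : Measurable h) {l m : ℝ} (hl : 0 < l) (hm : 0 < m) (hlm : l + m = 1)
    (H : ∀ x y, f x ^ l * g y ^ m ≤ h (l * x + m * y)) :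
    (∫⁻ x, f x) ^ l * (∫⁻ x, g x) ^ m ≤ ∫⁻ x, h x := by
  have trunc : ∀ u : ℝ → ℝ≥0∞, Measurable u → ∫⁻ x, u x = ⨆ k : ℕ, ∫⁻ x, min (u x) k := by
    intro u hu
    rw [← lintegral_iSup (fun k => hu.min measurable_const)]
    · refine lintegral_congr fun x => ?_
      rw [← inf_iSup_eq]
      simp [ENNReal.iSup_natCast]
    · intro i j hij x
      exact min_le_min_left _ (by exact_mod_cast hij)
  have rp : ∀ (c : ℝ) (hc : 0 < c) (u : ℕ → ℝ≥0∞), (⨆ k, u k) ^ c = ⨆ k, u k ^ c := fun c hc u =>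
    (ENNReal.orderIsoRpow c hc).map_iSup u
  rw [trunc f hf, trunc g hg, rp l hl, rp m hm, ENNReal.iSup_mul]
  refine iSup_le fun i => ?_
  rw [ENNReal.mul_iSup]
  refine iSup_le fun j => ?_
  refine prekopa_leindler_real_of_bounded (hf.min measurable_const) (hg.min measurable_const) hh
    hl hm hlm ?_ ?_ fun x y => le_trans ?_ (H x y)
  · exact ((iSup_le fun x => min_le_right _ _).trans_lt (ENNReal.natCast_lt_top i)).ne
  · exact ((iSup_le fun x => min_le_right _ _).trans_lt (ENNReal.natCast_lt_top j)).ne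
  · gcongr <;> exact min_le_left _ _

/-- Induction by slicing off one coordinate: the inner integrals satisfy the one-dimensional
hypothesis by the induction hypothesis. -/
theorem prekopa_leindler_pi {l m : ℝ} (hl : 0 < l) (hm : 0 < m) (hlm : l + m = 1) (n : ℕ)
    {f g h : (Fin n → ℝ) → ℝ≥0∞} (hf : Measurable f) (hg : Measurable g) (hh : Measurable h)
    (H : ∀ x y, f x ^ l * g y ^ m ≤ h (l • x + m • y)) :
    (∫⁻ x, f x) ^ l * (∫⁻ x, g x) ^ m ≤ ∫⁻ x, h x := by
  induction n with
  | zero =>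
    have e : ∀ u : (Fin 0 → ℝ) → ℝ≥0∞, ∫⁻ x, u x = u default := fun u => by
      rw [volume_pi, Measure.pi_of_empty _ default, lintegral_dirac]
    rw [e, e, e]
    exact (H default default).trans_eq (congrArg h (Subsingleton.elim _ _))
  | succ n ih =>
    have slice : ∀ u : (Fin (n + 1) → ℝ) → ℝ≥0∞, Measurable u →
        Measurable (fun p : ℝ × (Fin n → ℝ) => u (Fin.cons p.1 p.2)) ∧
        ∫⁻ x, u x = ∫⁻ s, ∫⁻ y, u (Fin.cons s y) := by
      intro u hu
      have e := (volume_preserving_piFinSuccAbove (fun _ : Fin (n + 1) => ℝ) 0).symm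
      have eq : ∀ p : ℝ × (Fin n → ℝ),
          (MeasurableEquiv.piFinSuccAbove (fun _ : Fin (n + 1) => ℝ) 0).symm p =
            Fin.cons p.1 p.2 := fun p => by
        simp [MeasurableEquiv.piFinSuccAbove, Fin.consEquiv]
      have hmeas : Measurable (fun p : ℝ × (Fin n → ℝ) => u (Fin.cons p.1 p.2)) := by
        simp only [← eq]
        exact hu.comp (MeasurableEquiv.measurable _)
      refine ⟨hmeas, ?_⟩
      rw [← e.lintegral_comp hu]
      simp only [eq]
      rw [Measure.volume_eq_prod, lintegral_prod _ hmeas.aemeasurable]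
    obtain ⟨mf, ef⟩ := slice f hf
    obtain ⟨mg, eg⟩ := slice g hg
    obtain ⟨mh, eh⟩ := slice h hh
    rw [ef, eg, eh]
    refine prekopa_leindler_real mf.lintegral_prod_right' mg.lintegral_prod_right'
      mh.lintegral_prod_right' hl hm hlm fun s t => ?_
    refine ih (mf.comp measurable_prodMk_left) (mg.comp measurable_prodMk_left)
      (mh.comp measurable_prodMk_left) fun x y => (H _ _).trans_eq ?_
    congr 1
    funext i
    refine Fin.cases ?_ (fun j => ?_) i <;> simp

theorem prekopa_leindler {n : ℕ} {l m : ℝ} (hl : 0 < l) (hm : 0 < m) (hlm : l + m = 1)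
    {f g h : EuclideanSpace ℝ (Fin n) → ℝ≥0∞} (hf : Measurable f) (hg : Measurable g)
    (hh : Measurable h) (H : ∀ x y, f x ^ l * g y ^ m ≤ h (l • x + m • y)) :
    (∫⁻ x, f x) ^ l * (∫⁻ x, g x) ^ m ≤ ∫⁻ x, h x := by
  have e := PiLp.volume_preserving_toLp (Fin n)
  rw [← e.lintegral_comp hf, ← e.lintegral_comp hg, ← e.lintegral_comp hh]
  exact prekopa_leindler_pi hl hm hlm n (hf.comp e.measurable) (hg.comp e.measurable)
    (hh.comp e.measurable) fun x y => H _ _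

end PrekopaLeindler

/-! ### Equality in Brunn–Minkowski for bodies of volume 1. -/

section PrekopaLeindlerEquality

open MeasureTheory Set ProbabilityTheory Filter Topology

theorem integrableExpSet_restrict_eq_univ {n : ℕ} {A : Set (EuclideanSpace ℝ (Fin n))}
    (hA : IsCompact A) {φ : EuclideanSpace ℝ (Fin n) → ℝ} (hφ : Continuous φ) :
    integrableExpSet φ (volume.restrict A) = univ := by
  refine eq_univ_of_forall fun t => ?_
  exact ContinuousOn.integrableOn_compact hA (by fun_prop)

theorem analyticAt_cgf_restrict {n : ℕ} {A : Set (EuclideanSpace ℝ (Fin n))}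
    (hA : IsCompact A) {φ : EuclideanSpace ℝ (Fin n) → ℝ} (hφ : Continuous φ) (t : ℝ) :
    AnalyticAt ℝ (cgf φ (volume.restrict A)) t :=
  analyticAt_cgf (by simp [integrableExpSet_restrict_eq_univ hA hφ])

theorem deriv_cgf_restrict_zero {n : ℕ} {A : Set (EuclideanSpace ℝ (Fin n))}
    (hA : IsCompact A) (hA1 : volume A = 1) {φ : EuclideanSpace ℝ (Fin n) → ℝ}
    (hφ : Continuous φ) :
    deriv (cgf φ (volume.restrict A)) 0 = ∫ x in A, φ x := by
  rw [deriv_cgf_zero (by simp [integrableExpSet_restrict_eq_univ hA hφ])]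
  simp [measureReal_def, hA1]

theorem deriv_deriv_cgf_restrict_zero {n : ℕ} {A : Set (EuclideanSpace ℝ (Fin n))}
    (hA : IsCompact A) (hA1 : volume A = 1) {φ : EuclideanSpace ℝ (Fin n) → ℝ}
    (hφ : Continuous φ) :
    deriv (deriv (cgf φ (volume.restrict A))) 0 = ∫ x in A, (φ x - ∫ y in A, φ y) ^ 2 := by
  have h := iteratedDeriv_two_cgf_eq_integral (X := φ) (μ := volume.restrict A) (v := 0)
    (by simp [integrableExpSet_restrict_eq_univ hA hφ])
  rw [iteratedDeriv_succ, iteratedDeriv_one] at h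
  rw [h, deriv_cgf_restrict_zero hA hA1 hφ]
  simp [measureReal_def, hA1]

/-- Logarithm of Prékopa–Leindler for `exp (t φ)`, `exp (t ψ)`, `exp (t χ)` cut off to the bodies.
The factor `t` stays in `H` so that negative `t` is allowed when the functions satisfy an equality.
-/
theorem cgf_restrict_add_le {n : ℕ} {A B M : Set (EuclideanSpace ℝ (Fin n))} (hA : IsCompact A)
    (hB : IsCompact B) (hM : IsCompact M) (hA1 : volume A = 1) (hB1 : volume B = 1)
    {l m : ℝ} (hl : 0 < l) (hm : 0 < m) (hlm : l + m = 1)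
    (hsub : ∀ x ∈ A, ∀ y ∈ B, l • x + m • y ∈ M)
    {φ ψ χ : EuclideanSpace ℝ (Fin n) → ℝ} (hφ : Continuous φ) (hψ : Continuous ψ)
    (hχ : Continuous χ) {t : ℝ}
    (H : ∀ x ∈ A, ∀ y ∈ B, t * (l * φ x + m * ψ y) ≤ t * χ (l • x + m • y)) :
    l * cgf φ (volume.restrict A) t + m * cgf ψ (volume.restrict B) t ≤
      cgf χ (volume.restrict M) t := by
  have conv : ∀ {S : Set (EuclideanSpace ℝ (Fin n))} {u : EuclideanSpace ℝ (Fin n) → ℝ},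
      IsCompact S → Continuous u →
      Measurable (S.indicator fun x => ENNReal.ofReal (Real.exp (t * u x))) ∧
      ∫⁻ x, S.indicator (fun x => ENNReal.ofReal (Real.exp (t * u x))) x =
        ENNReal.ofReal (mgf u (volume.restrict S) t) := by
    intro S u hS hu
    have hc : Continuous fun x => ENNReal.ofReal (Real.exp (t * u x)) :=
      ENNReal.continuous_ofReal.comp (by fun_prop)
    refine ⟨hc.measurable.indicator hS.measurableSet, ?_⟩
    rw [lintegral_indicator hS.measurableSet, mgf, ofReal_integral_eq_lintegral_ofReal]
    · exact ContinuousOn.integrableOn_compact hS (by fun_prop)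
    · exact Eventually.of_forall fun x => (Real.exp_pos _).le
  obtain ⟨mA, eA⟩ := conv hA hφ
  obtain ⟨mB, eB⟩ := conv hB hψ
  obtain ⟨mM, eM⟩ := conv hM hχ
  have key := prekopa_leindler hl hm hlm mA mB mM fun x y => by
    by_cases hx : x ∈ A
    · by_cases hy : y ∈ B
      · rw [indicator_of_mem hx, indicator_of_mem hy, indicator_of_mem (hsub x hx y hy),
          ENNReal.ofReal_rpow_of_pos (Real.exp_pos _), ENNReal.ofReal_rpow_of_pos (Real.exp_pos _),
          ← ENNReal.ofReal_mul (by positivity), ← Real.exp_mul, ← Real.exp_mul, ← Real.exp_add]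
        refine ENNReal.ofReal_le_ofReal (Real.exp_le_exp.2 ?_)
        calc t * φ x * l + t * ψ y * m = t * (l * φ x + m * ψ y) := by ring
          _ ≤ _ := H x hx y hy
      · simp [hy, hm]
    · simp [hx, hl]
  have pos : ∀ {S : Set (EuclideanSpace ℝ (Fin n))} {u : EuclideanSpace ℝ (Fin n) → ℝ},
      IsCompact S → Continuous u → volume S = 1 → 0 < mgf u (volume.restrict S) t := by
    intro S u hS hu h1
    refine mgf_pos' ?_ ?_
    · intro h
      have := congrArg (fun μ => μ univ) h
      simp [h1] at this
    · exact ContinuousOn.integrableOn_compact hS (by fun_prop)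
  have pA := pos hA hφ hA1
  have pB := pos hB hψ hB1
  rw [eA, eB, eM, ENNReal.ofReal_rpow_of_pos pA, ENNReal.ofReal_rpow_of_pos pB,
    ← ENNReal.ofReal_mul (by positivity), ENNReal.ofReal_le_ofReal_iff mgf_nonneg] at key
  have := Real.log_le_log (by positivity) key
  rw [Real.log_mul (by positivity) (by positivity), Real.log_rpow pA, Real.log_rpow pB] at this
  exact this

/-- First-order consequence of the Prékopa–Leindler inequality at a case of equality. -/
theorem setIntegral_add_le_of_volume_eq_one {n : ℕ} {A B M : Set (EuclideanSpace ℝ (Fin n))}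
    (hA : IsCompact A) (hB : IsCompact B) (hM : IsCompact M)
    (hA1 : volume A = 1) (hB1 : volume B = 1) (hM1 : volume M = 1)
    {l m : ℝ} (hl : 0 < l) (hm : 0 < m) (hlm : l + m = 1)
    (hsub : ∀ x ∈ A, ∀ y ∈ B, l • x + m • y ∈ M)
    {φ ψ χ : EuclideanSpace ℝ (Fin n) → ℝ} (hφ : Continuous φ) (hψ : Continuous ψ)
    (hχ : Continuous χ)
    (H : ∀ x ∈ A, ∀ y ∈ B, l * φ x + m * ψ y ≤ χ (l • x + m • y)) :
    l * (∫ x in A, φ x) + m * (∫ x in B, ψ x) ≤ ∫ x in M, χ x := by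
  set G : ℝ → ℝ := fun t => cgf χ (volume.restrict M) t -
    (l * cgf φ (volume.restrict A) t + m * cgf ψ (volume.restrict B) t) with hG
  have hd : HasDerivAt G ((∫ x in M, χ x) - (l * (∫ x in A, φ x) + m * (∫ x in B, ψ x))) 0 := by
    rw [← deriv_cgf_restrict_zero hA hA1 hφ, ← deriv_cgf_restrict_zero hB hB1 hψ,
      ← deriv_cgf_restrict_zero hM hM1 hχ]
    exact (analyticAt_cgf_restrict hM hχ 0).differentiableAt.hasDerivAt.sub
      (((analyticAt_cgf_restrict hA hφ 0).differentiableAt.hasDerivAt.const_mul l).add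
        ((analyticAt_cgf_restrict hB hψ 0).differentiableAt.hasDerivAt.const_mul m))
  have hG0 : G 0 = 0 := by simp [hG, cgf_zero', measureReal_def, hA1, hB1, hM1]
  have := ge_of_tendsto (b := 0) hd.tendsto_slope_zero_right (by
    filter_upwards [self_mem_nhdsWithin] with t ht
    have ht : 0 < t := ht
    rw [zero_add, hG0, sub_zero, smul_eq_mul]
    refine mul_nonneg (inv_pos.2 ht).le (sub_nonneg.2 ?_)
    exact cgf_restrict_add_le hA hB hM hA1 hB1 hl hm hlm hsub hφ hψ hχ
      fun x hx y hy => mul_le_mul_of_nonneg_left (H x hx y hy) ht.le)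
  linarith

/-- Second-order consequence of the Prékopa–Leindler inequality at a case of equality. -/
theorem variance_add_le_of_volume_eq_one {n : ℕ} {A B M : Set (EuclideanSpace ℝ (Fin n))}
    (hA : IsCompact A) (hB : IsCompact B) (hM : IsCompact M)
    (hA1 : volume A = 1) (hB1 : volume B = 1) (hM1 : volume M = 1)
    {l m : ℝ} (hl : 0 < l) (hm : 0 < m) (hlm : l + m = 1)
    (hsub : ∀ x ∈ A, ∀ y ∈ B, l • x + m • y ∈ M)
    {φ : EuclideanSpace ℝ (Fin n) → ℝ} (hφ : Continuous φ)
    (H : ∀ x y, φ (l • x + m • y) = l * φ x + m * φ y) :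
    ∫ x in M, φ x = l * (∫ x in A, φ x) + m * (∫ x in B, φ x) ∧
    l * (∫ x in A, (φ x - ∫ y in A, φ y) ^ 2) + m * (∫ x in B, (φ x - ∫ y in B, φ y) ^ 2) ≤
      ∫ x in M, (φ x - ∫ y in M, φ y) ^ 2 := by
  have aA := analyticAt_cgf_restrict hA hφ
  have aB := analyticAt_cgf_restrict hB hφ
  have aM := analyticAt_cgf_restrict hM hφ
  set G : ℝ → ℝ := fun t => cgf φ (volume.restrict M) t -
    (l * cgf φ (volume.restrict A) t + m * cgf φ (volume.restrict B) t) with hG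
  have hd : ∀ t, HasDerivAt G (deriv (cgf φ (volume.restrict M)) t -
      (l * deriv (cgf φ (volume.restrict A)) t + m * deriv (cgf φ (volume.restrict B)) t)) t :=
    fun t => (aM t).differentiableAt.hasDerivAt.sub
      (((aA t).differentiableAt.hasDerivAt.const_mul l).add
        ((aB t).differentiableAt.hasDerivAt.const_mul m))
  have hG0 : G 0 = 0 := by simp [hG, cgf_zero', measureReal_def, hA1, hB1, hM1]
  -- Since `H` is an equality, both signs of `t` are available: `G` has a two-sided minimum at 0,
  -- and `G' 0 = 0` is the identity for means.
  have hGnn : ∀ t, 0 ≤ G t := fun t => sub_nonneg.2 <|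
    cgf_restrict_add_le hA hB hM hA1 hB1 hl hm hlm hsub hφ hφ hφ fun x _ y _ => by rw [H]
  have hmin : IsLocalMin G 0 := Eventually.of_forall fun t => by rw [hG0]; exact hGnn t
  have hd0 := hmin.deriv_eq_zero
  have hdG := hd0
  rw [(hd 0).deriv, deriv_cgf_restrict_zero hA hA1 hφ, deriv_cgf_restrict_zero hB hB1 hφ,
    deriv_cgf_restrict_zero hM hM1 hφ] at hd0
  refine ⟨by linarith, ?_⟩
  have hdd : deriv (deriv G) 0 = deriv (deriv (cgf φ (volume.restrict M))) 0 -
      (l * deriv (deriv (cgf φ (volume.restrict A))) 0 +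
        m * deriv (deriv (cgf φ (volume.restrict B))) 0) := by
    rw [show deriv G = _ from funext fun t => (hd t).deriv]
    exact ((aM 0).deriv.differentiableAt.hasDerivAt.sub
      (((aA 0).deriv.differentiableAt.hasDerivAt.const_mul l).add
        ((aB 0).deriv.differentiableAt.hasDerivAt.const_mul m))).deriv
  rw [deriv_deriv_cgf_restrict_zero hA hA1 hφ, deriv_deriv_cgf_restrict_zero hB hB1 hφ,
    deriv_deriv_cgf_restrict_zero hM hM1 hφ] at hdd
  -- If `G'' 0 < 0`, then 0 would be both a local maximum and a global minimum, so `G` would vanish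
  -- nearby and `G'' 0 = 0`.
  have hnn : 0 ≤ deriv (deriv G) 0 := by
    by_contra hneg
    push Not at hneg
    have hmax := isLocalMax_of_deriv_deriv_neg hneg hdG (hd 0).continuousAt
    have hz : G =ᶠ[𝓝 0] fun _ => 0 := by
      filter_upwards [hmax] with t ht
      exact le_antisymm (ht.trans hG0.le) (hGnn t)
    have := hz.deriv.deriv_eq
    simp at this
    exact hneg.ne this
  linarith

theorem norm_sq_add_smul_eq {E : Type*} [NormedAddCommGroup E] [InnerProductSpace ℝ E]
    {l m : ℝ} (hlm : l + m = 1) (u v : E) :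
    ‖l • u + m • v‖ ^ 2 = l * ‖u‖ ^ 2 + m * ‖v‖ ^ 2 - l * m * ‖u - v‖ ^ 2 := by
  rw [@norm_add_sq_real, @norm_sub_sq_real, norm_smul, norm_smul, inner_smul_left,
    inner_smul_right, mul_pow, mul_pow, Real.norm_eq_abs, Real.norm_eq_abs, sq_abs, sq_abs]
  obtain rfl : m = 1 - l := by linarith
  simp
  ring

/-- The coordinatewise mean of the uniform distribution on a set of volume `1`. -/
noncomputable def setMean {n : ℕ} (A : Set (EuclideanSpace ℝ (Fin n))) :
    EuclideanSpace ℝ (Fin n) :=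
  WithLp.toLp 2 fun i => ∫ x in A, x i

theorem setIntegral_norm_sub_setMean_sq {n : ℕ} {A : Set (EuclideanSpace ℝ (Fin n))}
    (hA : IsCompact A) : ∫ x in A, ‖x - setMean A‖ ^ 2 =
      ∑ i, ∫ x in A, (x i - ∫ y in A, y i) ^ 2 := by
  rw [← integral_finsetSum]
  · simp [EuclideanSpace.real_norm_sq_eq, setMean]
  · intro i _
    exact ContinuousOn.integrableOn_compact hA (by fun_prop)

/-- The first-order inequality for minus the squared distance to the means leaves the slack `l m ‖u
- v‖²`, enough to absorb a small Lipschitz perturbation. The variance inequality rules out any gain.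
-/
theorem setIntegral_le_of_volume_eq_one {n : ℕ} {A B M : Set (EuclideanSpace ℝ (Fin n))}
    (hA : IsCompact A) (hB : IsCompact B) (hM : IsCompact M)
    (hA1 : volume A = 1) (hB1 : volume B = 1) (hM1 : volume M = 1)
    {l m : ℝ} (hl : 0 < l) (hm : 0 < m) (hlm : l + m = 1)
    (hsub : ∀ x ∈ A, ∀ y ∈ B, l • x + m • y ∈ M)
    {η : EuclideanSpace ℝ (Fin n) → ℝ} (hη : Continuous η)
    (hη1 : ∀ u v, η u - η v ≤ ‖u - v‖) :
    ∫ x in A, η (x - setMean A) ≤ ∫ x in B, η (x - setMean B) := by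
  have hvar := fun i : Fin n => variance_add_le_of_volume_eq_one hA hB hM hA1 hB1 hM1 hl hm hlm
    hsub (φ := fun x => x i) (by fun_prop) (fun x y => by simp)
  have hmean : setMean M = l • setMean A + m • setMean B := by
    ext i
    simpa [setMean] using (hvar i).1
  have hV : l * (∫ x in A, ‖x - setMean A‖ ^ 2) + m * (∫ x in B, ‖x - setMean B‖ ^ 2) ≤
      ∫ x in M, ‖x - setMean M‖ ^ 2 := by
    rw [setIntegral_norm_sub_setMean_sq hA, setIntegral_norm_sub_setMean_sq hB,
      setIntegral_norm_sub_setMean_sq hM, Finset.mul_sum, Finset.mul_sum, ← Finset.sum_add_distrib]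
    exact Finset.sum_le_sum fun i _ => (hvar i).2
  by_contra! hlt
  set P := ∫ x in A, η (x - setMean A)
  set Q := ∫ x in B, η (x - setMean B)
  set ε := P - Q with hε
  have hε0 : 0 < ε := sub_pos.2 hlt
  -- The coefficients come from `2 ε d ≤ d² + ε²`. Integrated, they leave a gain of `2 ε (P - Q) -
  -- ε² = ε²`, times `l m`.
  have key := setIntegral_add_le_of_volume_eq_one hA hB hM hA1 hB1 hM1 hl hm hlm hsub
    (φ := fun x => -‖x - setMean A‖ ^ 2 + m * (2 * ε) * η (x - setMean A))
    (ψ := fun y => -‖y - setMean B‖ ^ 2 + (-(l * (2 * ε)) * η (y - setMean B) - l * ε ^ 2))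
    (χ := fun z => -‖z - setMean M‖ ^ 2) (by fun_prop) (by fun_prop) (by fun_prop) (by
      intro x _ y _
      have e : l • x + m • y - setMean M = l • (x - setMean A) + m • (y - setMean B) := by
        rw [hmean, smul_sub, smul_sub]; abel
      rw [e, norm_sq_add_smul_eq hlm]
      have h1 := hη1 (x - setMean A) (y - setMean B)
      set d := ‖x - setMean A - (y - setMean B)‖
      have h2 : 2 * ε * (η (x - setMean A) - η (y - setMean B)) ≤ d ^ 2 + ε ^ 2 := by
        nlinarith [sq_nonneg (d - ε)]
      have h3 := mul_le_mul_of_nonneg_left h2 (mul_pos hl hm).le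
      nlinarith)
  have iA : ∀ {u : EuclideanSpace ℝ (Fin n) → ℝ}, Continuous u → IntegrableOn u A :=
    fun hu => hu.continuousOn.integrableOn_compact hA
  have iB : ∀ {u : EuclideanSpace ℝ (Fin n) → ℝ}, Continuous u → IntegrableOn u B :=
    fun hu => hu.continuousOn.integrableOn_compact hB
  rw [integral_add (iA (by fun_prop)) (iA (by fun_prop)),
    integral_add (iB (by fun_prop)) (iB (by fun_prop)),
    integral_sub (iB (by fun_prop)) (iB (by fun_prop)),
    integral_neg, integral_neg, integral_neg, integral_const_mul, integral_const_mul,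
    setIntegral_const] at key
  simp only [measureReal_def, hB1, ENNReal.toReal_one, one_smul] at key
  have : l * m * ε ^ 2 ≤ 0 := by
    have e : P = Q + ε := by rw [hε]; ring
    change l * (-_ + m * (2 * ε) * P) + m * (-_ + (-(l * (2 * ε)) * Q - l * ε ^ 2)) ≤ _ at key
    rw [e] at key
    nlinarith
  exact absurd this (not_le.2 (by positivity))

/-- Take for `η` the distance to the centred `B`: its integral over `B` is zero, hence also over
`A`. Regularity of `A` upgrades almost everywhere to everywhere. -/
theorem subset_translate_of_volume_eq_one {n : ℕ} {A B M : Set (EuclideanSpace ℝ (Fin n))}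
    (hA : IsCompact A) (hB : IsCompact B) (hM : IsCompact M)
    (hA1 : volume A = 1) (hB1 : volume B = 1) (hM1 : volume M = 1)
    (hAreg : A ⊆ closure (interior A))
    {l m : ℝ} (hl : 0 < l) (hm : 0 < m) (hlm : l + m = 1)
    (hsub : ∀ x ∈ A, ∀ y ∈ B, l • x + m • y ∈ M) :
    ∀ x ∈ A, x + (setMean B - setMean A) ∈ B := by
  have hBne : B.Nonempty := nonempty_of_measure_ne_zero (μ := volume) (by simp [hB1])
  have hη : Continuous fun u => Metric.infDist (u + setMean B) B :=
    (Metric.continuous_infDist_pt B).comp (by fun_prop)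
  have key := setIntegral_le_of_volume_eq_one hA hB hM hA1 hB1 hM1 hl hm hlm hsub hη
    (fun u v => by
      have := Metric.infDist_le_infDist_add_dist (s := B) (x := u + setMean B)
        (y := v + setMean B)
      rw [dist_add_right, dist_eq_norm] at this
      linarith)
  have hz : ∫ x in B, Metric.infDist (x - setMean B + setMean B) B = 0 := by
    rw [setIntegral_congr_fun (g := fun _ => (0 : ℝ)) hB.measurableSet]
    · simp
    · intro x hx
      simp [Metric.infDist_zero_of_mem hx]
  have hcont : Continuous fun x => Metric.infDist (x - setMean A + setMean B) B :=
    (Metric.continuous_infDist_pt B).comp (by fun_prop)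
  have h0 : ∫ x in A, Metric.infDist (x - setMean A + setMean B) B = 0 :=
    le_antisymm (key.trans hz.le) (integral_nonneg fun x => Metric.infDist_nonneg)
  have hae := (integral_eq_zero_iff_of_nonneg (fun x => Metric.infDist_nonneg)
    (hcont.continuousOn.integrableOn_compact hA)).1 h0
  have heq := Measure.eqOn_of_ae_eq hae hcont.continuousOn continuousOn_const hAreg
  intro x hx
  have := (hB.isClosed.mem_iff_infDist_zero hBne).2 (heq hx)
  convert this using 1
  abel

/-- Equality case of the Brunn–Minkowski inequality for bodies of volume `1`. -/
theorem exists_translate_eq_of_volume_eq_one {n : ℕ} {A B M : Set (EuclideanSpace ℝ (Fin n))}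
    (hA : IsCompact A) (hB : IsCompact B) (hM : IsCompact M)
    (hA1 : volume A = 1) (hB1 : volume B = 1) (hM1 : volume M = 1)
    (hAreg : A ⊆ closure (interior A)) (hBreg : B ⊆ closure (interior B))
    {l m : ℝ} (hl : 0 < l) (hm : 0 < m) (hlm : l + m = 1)
    (hsub : ∀ x ∈ A, ∀ y ∈ B, l • x + m • y ∈ M) :
    ∃ z, ∀ x, x + z ∈ B ↔ x ∈ A := by
  refine ⟨setMean B - setMean A, fun x => ⟨fun hx => ?_, fun hx =>
    subset_translate_of_volume_eq_one hA hB hM hA1 hB1 hM1 hAreg hl hm hlm hsub x hx⟩⟩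
  have := subset_translate_of_volume_eq_one hB hA hM hB1 hA1 hM1 hBreg hm hl (by linarith)
    (fun y hy x hx => by rw [add_comm]; exact hsub x hx y hy) _ hx
  convert this using 1
  abel

end PrekopaLeindlerEquality

/-! ### Convex families with affine n-th root of volume. -/

section ConvexFamily

open MeasureTheory Set Filter Topology
open scoped Pointwise

theorem Convex.interior_nonempty_of_volume_ne_zero {n : ℕ} {C : Set (EuclideanSpace ℝ (Fin n))}
    (hC : Convex ℝ C) (h0 : volume C ≠ 0) : (interior C).Nonempty := by
  by_contra h
  rw [not_nonempty_iff_eq_empty] at h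
  refine h0 (measure_mono_null (fun x hx => ?_) (hC.addHaar_frontier volume))
  exact ⟨subset_closure hx, by simp [h]⟩

/-- A ball in `C` and a distant point of `C` span a set containing as many disjoint balls of half
the radius as desired. -/
theorem Convex.isBounded_of_volume_ne_top {n : ℕ} {C : Set (EuclideanSpace ℝ (Fin n))}
    (hC : Convex ℝ C) (h0 : volume C ≠ 0) (hfin : volume C ≠ ∞) : Bornology.IsBounded C := by
  obtain ⟨c, hc⟩ := hC.interior_nonempty_of_volume_ne_zero h0
  obtain ⟨r, hr, hball⟩ := Metric.mem_nhds_iff.1 (mem_interior_iff_mem_nhds.1 hc)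
  by_contra hunb
  set V := volume (Metric.ball (0 : EuclideanSpace ℝ (Fin n)) (r / 2)) with hV
  have hV0 : V ≠ 0 := (Metric.measure_ball_pos volume _ (by positivity)).ne'
  obtain ⟨N, hN⟩ := ENNReal.exists_nat_mul_gt hV0 hfin
  have hx : ∃ x ∈ C, 2 * (N + 1) * r < ‖x - c‖ := by
    by_contra! hall
    refine hunb ((Metric.isBounded_closedBall (x := c) (r := 2 * (N + 1) * r)).subset fun x hx => ?_)
    simpa [dist_eq_norm] using hall x hx
  obtain ⟨x, hxC, hxr⟩ := hx
  set R := ‖x - c‖ with hR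
  have hR0 : 0 < R := lt_trans (by positivity) hxr
  -- Centres `r` apart, all on the first half of the segment, where the convex hull still has radius
  -- at least `r / 2`.
  set p : ℕ → EuclideanSpace ℝ (Fin n) := fun j => c + (j * r / R) • (x - c) with hp
  have hs : ∀ j < N, (j * r / R : ℝ) ≤ 1 / 2 := by
    intro j hj
    have : (j : ℝ) < N := by exact_mod_cast hj
    rw [div_le_iff₀ hR0]
    nlinarith
  have hsubset : ∀ j < N, Metric.ball (p j) (r / 2) ⊆ C := by
    intro j hj y hy
    have hsj := hs j hj
    set s : ℝ := j * r / R with hsdef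
    have hs0 : 0 ≤ s := by positivity
    have hs1 : 0 < 1 - s := by linarith
    have hu : c + (1 - s)⁻¹ • (y - p j) ∈ C := by
      apply hball
      rw [Metric.mem_ball, dist_eq_norm, add_sub_cancel_left, norm_smul, Real.norm_eq_abs,
        abs_of_pos (inv_pos.2 hs1), inv_mul_lt_iff₀ hs1]
      rw [Metric.mem_ball, dist_eq_norm] at hy
      nlinarith
    have := hC hu hxC hs1.le hs0 (by ring)
    convert this using 1
    rw [smul_add, smul_inv_smul₀ hs1.ne', hp]
    module
  have hdisj : ((Finset.range N : Finset ℕ) : Set ℕ).PairwiseDisjoint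
      fun j => Metric.ball (p j) (r / 2) := by
    intro i _ j _ hij
    apply Metric.ball_disjoint_ball
    have e : p i - p j = ((i - j : ℝ) * r / R) • (x - c) := by
      rw [hp]; module
    rw [dist_eq_norm, e, norm_smul, ← hR, Real.norm_eq_abs, abs_div, abs_mul, abs_of_pos hr,
      abs_of_pos hR0, div_mul_cancel₀ _ hR0.ne']
    have h1 : (1 : ℝ) ≤ |(i - j : ℝ)| := by
      have : (1 : ℤ) ≤ |(i - j : ℤ)| := Int.one_le_abs (by omega)
      exact_mod_cast this
    nlinarith
  have hle : volume (⋃ j ∈ Finset.range N, Metric.ball (p j) (r / 2)) ≤ volume C :=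
    measure_mono (iUnion₂_subset fun j hj => hsubset j (Finset.mem_range.1 hj))
  rw [measure_biUnion_finset hdisj fun j _ => measurableSet_ball] at hle
  have hc : ∀ j, volume (Metric.ball (p j) (r / 2)) = V := fun j =>
    Measure.addHaar_ball_center volume _ _
  simp only [hc, Finset.sum_const, Finset.card_range, nsmul_eq_mul] at hle
  exact absurd hle (not_le.2 hN)

theorem eq_zero_of_isBounded_of_add_mem {E : Type*} [NormedAddCommGroup E] [NormedSpace ℝ E]
    {X : Set E} (hX : Bornology.IsBounded X) (hne : X.Nonempty) {u : E}
    (h : ∀ x ∈ X, x + u ∈ X) : u = 0 := by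
  obtain ⟨x, hx⟩ := hne
  have hk : ∀ k : ℕ, x + (k : ℝ) • u ∈ X := by
    intro k
    induction k with
    | zero => simpa using hx
    | succ k ih =>
      have := h _ ih
      rw [Nat.cast_succ, add_smul, one_smul, ← add_assoc]
      exact this
  obtain ⟨R, hR⟩ := hX.exists_norm_le
  by_contra hu
  have hu' : 0 < ‖u‖ := norm_pos_iff.2 hu
  obtain ⟨k, hk'⟩ := exists_nat_gt ((R + ‖x‖) / ‖u‖)
  rw [div_lt_iff₀ hu'] at hk'
  have h1 := hR _ (hk k)
  have h2 : ‖(k : ℝ) • u‖ ≤ ‖x + (k : ℝ) • u‖ + ‖x‖ := by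
    have := norm_sub_le (x + (k : ℝ) • u) x
    rwa [add_sub_cancel_left] at this
  rw [norm_smul, Real.norm_eq_abs, Nat.abs_cast] at h2
  linarith

/-- Equality case of the Brunn–Minkowski inequality: if the `n`-th root of the volume is additive
on the midpoints of two convex bodies, then the bodies are homothetic. -/
theorem exists_homothety_of_volume_midpoint {n : ℕ} {A B M : Set (EuclideanSpace ℝ (Fin n))}
    (hA : IsClosed A) (hB : IsClosed B) (hM : IsClosed M)
    (cA : Convex ℝ A) (cB : Convex ℝ B) (cM : Convex ℝ M) {α β : ℝ} (hα : 0 < α) (hβ : 0 < β)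
    (vA : volume A = ENNReal.ofReal (α ^ n)) (vB : volume B = ENNReal.ofReal (β ^ n))
    (vM : volume M = ENNReal.ofReal (((α + β) / 2) ^ n))
    (hsub : ∀ x ∈ A, ∀ y ∈ B, (1 / 2 : ℝ) • x + (1 / 2 : ℝ) • y ∈ M) :
    ∃ z, ∀ x, (β / α) • x + z ∈ B ↔ x ∈ A := by
  have norm : ∀ {S : Set (EuclideanSpace ℝ (Fin n))} {γ : ℝ}, IsClosed S → Convex ℝ S → 0 < γ →
      volume S = ENNReal.ofReal (γ ^ n) → IsCompact (γ⁻¹ • S) ∧ volume (γ⁻¹ • S) = 1 ∧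
        γ⁻¹ • S ⊆ closure (interior (γ⁻¹ • S)) := by
    intro S γ hS cS hγ vS
    have h0 : volume S ≠ 0 := by rw [vS]; simpa using pow_pos hγ n
    have hfin : volume S ≠ ∞ := by rw [vS]; exact ENNReal.ofReal_ne_top
    have v1 : volume (γ⁻¹ • S) = 1 := by
      rw [Measure.addHaar_smul, vS, ← ENNReal.ofReal_mul (abs_nonneg _), finrank_euclideanSpace,
        Fintype.card_fin, abs_of_pos (by positivity), inv_pow, inv_mul_cancel₀ (by positivity),
        ENNReal.ofReal_one]
    refine ⟨(Metric.isCompact_of_isClosed_isBounded hS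
      (cS.isBounded_of_volume_ne_top h0 hfin)).smul _, v1, ?_⟩
    rw [(cS.smul _).closure_interior_eq_closure_of_nonempty_interior
      ((cS.smul _).interior_nonempty_of_volume_ne_zero (by simp [v1]))]
    exact subset_closure
  obtain ⟨kA, A1, rA⟩ := norm hA cA hα vA
  obtain ⟨kB, B1, rB⟩ := norm hB cB hβ vB
  obtain ⟨kM, M1, -⟩ := norm hM cM (half_pos (add_pos hα hβ)) vM
  have hαβ : 0 < α + β := add_pos hα hβ
  -- With these weights, the midpoint of `α x` and `β y` is `(α + β) / 2` times `l x + m y`.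
  obtain ⟨z, hz⟩ := exists_translate_eq_of_volume_eq_one kA kB kM A1 B1 M1 rA rB
    (l := α / (α + β)) (m := β / (α + β)) (by positivity) (by positivity) (by field_simp) (by
      intro x hx y hy
      rw [mem_inv_smul_set_iff₀ (by positivity)] at hx hy ⊢
      convert hsub _ hx _ hy using 1
      rw [smul_add, smul_smul, smul_smul, smul_smul, smul_smul]
      congr 2 <;> field_simp)
  refine ⟨β • z, fun x => ?_⟩
  have := hz (α⁻¹ • x)
  rw [mem_inv_smul_set_iff₀ hβ.ne', mem_inv_smul_set_iff₀ hα.ne', smul_inv_smul₀ hα.ne', smul_add,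
    smul_smul] at this
  exact this

/-- Each `C t` is compared with `C 0` through the section at `t / 2`. Convexity of the graph makes
the translation vector affine, since any defect would translate the bounded set `C 0` into itself.
-/
theorem exists_homothetic_family_of_pos {n : ℕ} {C : ℝ → Set (EuclideanSpace ℝ (Fin n))}
    (hclosed : IsClosed {p : ℝ × EuclideanSpace ℝ (Fin n) | p.2 ∈ C p.1})
    (hconv : Convex ℝ {p : ℝ × EuclideanSpace ℝ (Fin n) | p.2 ∈ C p.1}) {f β : ℝ}
    (hβ : 0 < β) (hβf : β ≤ f)
    (hvol : ∀ t ∈ Icc (-1 : ℝ) 1, 0 < f + t * β →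
      volume (C t) = ENNReal.ofReal ((f + t * β) ^ n)) :
    ∃ v, ∀ t ∈ Icc (-1 : ℝ) 1, ∀ x, x ∈ C t ↔ ∃ c ∈ C 0, x = (1 + β / f * t) • c + t • v := by
  have hf : 0 < f := hβ.trans_le hβf
  have hcl : ∀ t, IsClosed (C t) := fun t =>
    hclosed.preimage (Continuous.prodMk_right t)
  have hcombo : ∀ {t₀ t₁ s : ℝ} {x y}, 0 ≤ s → s ≤ 1 → x ∈ C t₀ → y ∈ C t₁ →
      (1 - s) • x + s • y ∈ C ((1 - s) * t₀ + s * t₁) := by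
    intro t₀ t₁ s x y h0 h1 hx hy
    exact @hconv (t₀, x) hx (t₁, y) hy (1 - s) s (sub_nonneg.2 h1) h0 (by ring)
  have hcv : ∀ t, Convex ℝ (C t) := by
    intro t x hx y hy a b ha hb hab
    have := hcombo hb (by linarith) hx hy
    obtain rfl : a = 1 - b := by linarith
    convert this using 1
    ring_nf
  have v0 : volume (C 0) = ENNReal.ofReal (f ^ n) := by
    simpa using hvol 0 (by norm_num) (by simpa using hf)
  have vne : volume (C 0) ≠ 0 := by rw [v0]; simpa using pow_pos hf n
  have hbdd : Bornology.IsBounded (C 0) := (hcv 0).isBounded_of_volume_ne_top vne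
    (by rw [v0]; exact ENNReal.ofReal_ne_top)
  have hne : (C 0).Nonempty := nonempty_of_measure_ne_zero vne
  have hz : ∀ t : ℝ, ∃ z, t ∈ Icc (-1 : ℝ) 1 → 0 < f + t * β →
      ∀ x, (1 + β / f * t) • x + z ∈ C t ↔ x ∈ C 0 := by
    intro t
    by_cases ht : t ∈ Icc (-1 : ℝ) 1 ∧ 0 < f + t * β
    · have hmem : 0 / 2 + t / 2 ∈ Icc (-1 : ℝ) 1 := by
        constructor <;> linarith [ht.1.1, ht.1.2]
      obtain ⟨z, hz⟩ := exists_homothety_of_volume_midpoint (hcl 0) (hcl t) (hcl (0 / 2 + t / 2))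
        (hcv 0) (hcv t) (hcv _) hf ht.2 v0 (hvol t ht.1 ht.2)
        (by
          rw [hvol _ hmem (by linarith [ht.2])]
          ring_nf)
        (fun x hx y hy => by
          have := hcombo (s := 1 / 2) (by norm_num) (by norm_num) hx hy
          convert this using 2 <;> norm_num
          ring)
      refine ⟨z, fun _ _ x => ?_⟩
      rw [← hz x]
      congr! 3
      field_simp
    · exact ⟨0, fun h1 h2 => absurd ⟨h1, h2⟩ ht⟩
  choose z hz using hz
  have hcoef : ∀ {t : ℝ}, 0 < f + t * β → 0 < 1 + β / f * t := by
    intro t ht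
    have : 1 + β / f * t = (f + t * β) / f := by field_simp
    rw [this]
    positivity
  have hzaff : ∀ {t₀ t₁ s : ℝ}, t₀ ∈ Icc (-1 : ℝ) 1 → t₁ ∈ Icc (-1 : ℝ) 1 → 0 < f + t₀ * β →
      0 < f + t₁ * β → 0 ≤ s → s ≤ 1 →
      z ((1 - s) * t₀ + s * t₁) = (1 - s) • z t₀ + s • z t₁ := by
    intro t₀ t₁ s h0 h1 p0 p1 hs0 hs1
    set t := (1 - s) * t₀ + s * t₁ with ht
    have htI : t ∈ Icc (-1 : ℝ) 1 :=
      convex_Icc (-1 : ℝ) 1 h0 h1 (sub_nonneg.2 hs1) hs0 (by ring)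
    have hpos : 0 < f + t * β := by
      have : f + t * β = (1 - s) * (f + t₀ * β) + s * (f + t₁ * β) := by rw [ht]; ring
      rw [this]
      rcases hs0.eq_or_lt with rfl | hs
      · simpa using p0
      · have := mul_nonneg (sub_nonneg.2 hs1) p0.le
        have := mul_pos hs p1
        linarith
    have hc := hcoef hpos
    have key := eq_zero_of_isBounded_of_add_mem hbdd hne
      (u := (1 + β / f * t)⁻¹ • ((1 - s) • z t₀ + s • z t₁ - z t)) (by
        intro x hx
        rw [← hz t htI hpos, smul_add, smul_inv_smul₀ hc.ne']
        have := hcombo hs0 hs1 ((hz t₀ h0 p0 x).2 hx) ((hz t₁ h1 p1 x).2 hx)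
        convert this using 1
        rw [ht]
        module)
    rw [smul_eq_zero_iff_right (inv_ne_zero hc.ne'), sub_eq_zero] at key
    exact key.symm
  have hz0 : z 0 = 0 := by
    refine eq_zero_of_isBounded_of_add_mem hbdd hne fun x hx => ?_
    have := (hz 0 (by norm_num) (by simpa using hf) x).2 hx
    simpa using this
  have I0 : (0 : ℝ) ∈ Icc (-1 : ℝ) 1 := by norm_num
  have I1 : (1 : ℝ) ∈ Icc (-1 : ℝ) 1 := by norm_num
  have p0 : 0 < f + 0 * β := by simpa using hf
  have p1 : 0 < f + 1 * β := by linarith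
  have hzlin : ∀ t ∈ Icc (-1 : ℝ) 1, 0 < f + t * β → z t = t • z 1 := by
    intro t ht hp
    rcases le_total 0 t with h | h
    · have := hzaff I0 I1 p0 p1 h ht.2
      simpa [hz0] using this
    · have hd : 0 < 1 - t := by linarith
      -- The weight for which `(1 - s) t + s = 0`, placing 0 between `t` and 1.
      have := hzaff (s := -t / (1 - t)) ht I1 hp p1 (div_nonneg (by linarith) hd.le)
        (by rw [div_le_one hd]; linarith)
      rw [show (1 - -t / (1 - t)) * t + -t / (1 - t) * 1 = 0 by field_simp; ring, hz0] at this
      have e : (1 - t) • ((1 - -t / (1 - t)) • z t + (-t / (1 - t)) • z 1) = z t - t • z 1 := by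
        rw [smul_add, smul_smul, smul_smul,
          show (1 - t) * (1 - -t / (1 - t)) = 1 by field_simp; ring,
          show (1 - t) * (-t / (1 - t)) = -t by field_simp]
        module
      rw [← this, smul_zero] at e
      exact (sub_eq_zero.1 e.symm)
  refine ⟨z 1, fun t ht x => ?_⟩
  by_cases hp : 0 < f + t * β
  · have hc := hcoef hp
    constructor
    · intro hx
      refine ⟨(1 + β / f * t)⁻¹ • (x - t • z 1), ?_, ?_⟩
      · rw [← hz t ht hp, smul_inv_smul₀ hc.ne', hzlin t ht hp, sub_add_cancel]
        exact hx
      · rw [smul_inv_smul₀ hc.ne', sub_add_cancel]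
    · rintro ⟨c, hc, rfl⟩
      rw [← hzlin t ht hp]
      exact (hz t ht hp c).2 hc
  -- Degenerate endpoint, with ratio 0. A point of `C (-1)` averaged with `C 1` translates `C 0`
  -- into itself, so it must be `-z 1`; closedness of the graph shows that this point does occur.
  · obtain rfl : t = -1 := by nlinarith [ht.1]
    obtain rfl : f = β := by linarith
    have e0 : 1 + f / f * -1 = 0 := by rw [div_self hf.ne']; ring
    constructor
    · intro hx
      obtain ⟨c, hc⟩ := hne
      refine ⟨c, hc, ?_⟩
      have key := eq_zero_of_isBounded_of_add_mem hbdd ⟨c, hc⟩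
        (u := (1 / 2 : ℝ) • (x + z 1)) (by
          intro y hy
          have h1 := (hz 1 I1 p1 y).2 hy
          rw [div_self hf.ne'] at h1
          have := hcombo (s := 1 / 2) (by norm_num) (by norm_num) hx h1
          rw [show (1 - 1 / 2) * (-1 : ℝ) + 1 / 2 * 1 = 0 by norm_num] at this
          convert this using 1
          module)
      rw [smul_eq_zero_iff_right (by norm_num)] at key
      rw [e0, zero_smul, zero_add, neg_one_smul]
      exact eq_neg_of_add_eq_zero_left key
    · rintro ⟨c, hc, rfl⟩
      have hcont : Continuous fun s : ℝ => ((s, (1 + f / f * s) • c + s • z 1) :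
          ℝ × EuclideanSpace ℝ (Fin n)) := by fun_prop
      have hlim := (hcont.tendsto (-1)).mono_left (nhdsWithin_le_nhds (s := Ioi (-1 : ℝ)))
      suffices h : ((-1, (1 + f / f * -1) • c + (-1 : ℝ) • z 1) : ℝ × EuclideanSpace ℝ (Fin n)) ∈
          {p : ℝ × EuclideanSpace ℝ (Fin n) | p.2 ∈ C p.1} from h
      refine hclosed.mem_of_tendsto hlim ?_
      filter_upwards [Ioo_mem_nhdsGT (show (-1 : ℝ) < 0 by norm_num)] with s hs
      have hsI : s ∈ Icc (-1 : ℝ) 1 := ⟨hs.1.le, by linarith [hs.2]⟩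
      have hsp : 0 < f + s * f := by nlinarith [hs.1]
      have := (hz s hsI hsp c).2 hc
      rwa [hzlin s hsI hsp] at this

theorem exists_homothetic_family {n : ℕ} {C : ℝ → Set (EuclideanSpace ℝ (Fin n))}
    (hclosed : IsClosed {p : ℝ × EuclideanSpace ℝ (Fin n) | p.2 ∈ C p.1})
    (hconv : Convex ℝ {p : ℝ × EuclideanSpace ℝ (Fin n) | p.2 ∈ C p.1}) {f β : ℝ}
    (hβ : β ≠ 0) (hβf : |β| ≤ f)
    (hvol : ∀ t ∈ Icc (-1 : ℝ) 1, 0 < f + t * β →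
      volume (C t) = ENNReal.ofReal ((f + t * β) ^ n)) :
    ∃ v, ∀ t ∈ Icc (-1 : ℝ) 1, ∀ x, x ∈ C t ↔ ∃ c ∈ C 0, x = (1 + β / f * t) • c + t • v := by
  rcases hβ.lt_or_gt with h | h
  · have hcont : Continuous fun p : ℝ × EuclideanSpace ℝ (Fin n) => (-p.1, p.2) := by fun_prop
    obtain ⟨v, hv⟩ := exists_homothetic_family_of_pos (C := fun t => C (-t)) (f := f)
      (hclosed.preimage hcont)
      (by
        intro p hp q hq a b ha hb hab
        have := @hconv (-p.1, p.2) hp (-q.1, q.2) hq a b ha hb hab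
        simp only [mem_ofPred_eq, Prod.mk_add_mk, Prod.smul_mk, smul_eq_mul, Prod.fst_add,
          Prod.snd_add, Prod.smul_fst, Prod.smul_snd] at this ⊢
        convert this using 2
        ring)
      (neg_pos.2 h) (by rwa [abs_of_neg h] at hβf)
      (fun t ht hp => by
        rw [hvol (-t) ⟨by linarith [ht.2], by linarith [ht.1]⟩ (by linarith)]
        ring_nf)
    refine ⟨-v, fun t ht x => ?_⟩
    have := hv (-t) ⟨by linarith [ht.2], by linarith [ht.1]⟩ x
    simp only [neg_neg, neg_zero] at this
    rw [this]
    refine exists_congr fun c => and_congr_right fun _ => ?_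
    rw [show 1 + -β / f * -t = 1 + β / f * t by ring, neg_smul, smul_neg]
  · exact exists_homothetic_family_of_pos hclosed hconv h (by rwa [abs_of_pos h] at hβf) hvol

end ConvexFamily

/-! ### From homothetic sections to cones. -/

section Cones

open MeasureTheory Set Filter Topology

/-- The point equals `(1 - ε s) • (ρ • y) + (ε s) • k` with `ρ = (1 - ε) / (1 - ε s)`. The bound on
`ε` gives `ε s ≤ 1/2` and `|ρ - 1| ≤ δ`. -/
theorem Convex.exists_forall_add_smul_mem {E : Type*} [NormedAddCommGroup E] [NormedSpace ℝ E]
    {P : Set E} (hP : Convex ℝ P) {y k : E} {s δ : ℝ} (hδ : 0 < δ) (hs : 0 ≤ s)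
    (hy : ∀ ρ : ℝ, |ρ - 1| ≤ δ → ρ • y ∈ P) (hk : k ∈ P) :
    ∃ ε₀ > (0 : ℝ), ∀ ε : ℝ, 0 ≤ ε → ε ≤ ε₀ → (1 - ε) • y + ε • s • k ∈ P := by
  refine ⟨min 1 δ / (2 * (s + 1)), by positivity, fun ε h0 hε => ?_⟩
  have hmul : ε * (2 * (s + 1)) ≤ min 1 δ := (le_div_iff₀ (by positivity)).1 hε
  have m1 : ε * (2 * (s + 1)) ≤ 1 := hmul.trans (min_le_left _ _)
  have m2 : ε * (2 * (s + 1)) ≤ δ := hmul.trans (min_le_right _ _)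
  have hεs : ε * s ≤ 1 / 2 := by nlinarith
  have hd : 0 < 1 - ε * s := by linarith
  have hρ := hy ((1 - ε) / (1 - ε * s)) (by
    have : (1 - ε) / (1 - ε * s) - 1 = ε * (s - 1) / (1 - ε * s) := by field_simp; ring
    rw [this, abs_div, abs_of_pos hd, div_le_iff₀ hd, abs_le]
    constructor <;> nlinarith [mul_nonneg h0 hs])
  have := hP hρ hk hd.le (mul_nonneg h0 hs) (by ring)
  rwa [smul_smul, mul_div_cancel₀ _ hd.ne', mul_smul] at this

/-- If every point of `P ∩ (N + u)` can be moved a little along the rays through `0` in `P` and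
`u` in `N + u`, then `P ∩ (N + u)` contains the intersection of the cones generated by `P` and by
`N + u` with vertices `0` and `u`. -/
theorem mem_of_mem_cones {E : Type*} [NormedAddCommGroup E] [NormedSpace ℝ E] {P N : Set E}
    (hP : Convex ℝ P) (hN : Convex ℝ N) (cP : IsClosed P) (cN : IsClosed N) {u : E} {δ : ℝ}
    (hδ : 0 < δ)
    (hray : ∀ d, d ∈ P → d - u ∈ N → ∀ ρ : ℝ, |ρ - 1| ≤ δ → ρ • d ∈ P ∧ ρ • (d - u) ∈ N)
    {c : E} (hcP : c ∈ P) (hcN : c - u ∈ N) {x k m : E} {s s' : ℝ} (hk : k ∈ P) (hm : m ∈ N)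
    (hs : 0 ≤ s) (hs' : 0 ≤ s') (hx : x = s • k) (hxu : x - u = s' • m) :
    x ∈ P ∧ x - u ∈ N := by
  set S : Set ℝ := {τ | c + τ • (x - c) ∈ P ∧ c + τ • (x - c) - u ∈ N} with hS
  have hclosed : IsClosed S :=
    (cP.preimage (f := fun τ : ℝ => c + τ • (x - c)) (by fun_prop)).inter
      (cN.preimage (f := fun τ : ℝ => c + τ • (x - c) - u) (by fun_prop))
  have hsub : Icc (0 : ℝ) 1 ⊆ S := by
    -- Continuous induction along the segment from `c` to `x`.
    refine (hclosed.inter isClosed_Icc).Icc_subset_of_forall_exists_gt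
      (by simpa [hS] using ⟨hcP, hcN⟩) ?_
    rintro τ ⟨⟨h1, h2⟩, hτ0, hτ1⟩ Y hY
    set y := c + τ • (x - c) with hy
    obtain ⟨e₁, he₁, H₁⟩ := hP.exists_forall_add_smul_mem hδ hs
      (fun ρ hρ => (hray y h1 h2 ρ hρ).1) hk
    obtain ⟨e₂, he₂, H₂⟩ := hN.exists_forall_add_smul_mem hδ hs'
      (fun ρ hρ => (hray y h1 h2 ρ hρ).2) hm
    have hYτ : 0 < Y - τ := sub_pos.2 hY
    set ε := min (min e₁ e₂) (Y - τ) with hε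
    have hε0 : 0 < ε := lt_min (lt_min he₁ he₂) hYτ
    have hε1 : ε ≤ e₁ := (min_le_left _ _).trans (min_le_left _ _)
    have hε2 : ε ≤ e₂ := (min_le_left _ _).trans (min_le_right _ _)
    have hε3 : ε ≤ Y - τ := min_le_right _ _
    -- The parameter of `(1 - ε) • y + ε • x`.
    refine ⟨τ + ε * (1 - τ), ⟨?_, ?_⟩, ?_, ?_⟩
    · have := H₁ ε hε0.le hε1
      rw [← hx] at this
      convert this using 1
      rw [hy]; module
    · have := H₂ ε hε0.le hε2
      rw [← hxu] at this
      convert this using 1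
      rw [hy]; module
    · nlinarith
    · nlinarith
  have := hsub (right_mem_Icc.2 zero_le_one)
  simpa [hS] using this

theorem Convex.exists_smul_eq_add {E : Type*} [NormedAddCommGroup E] [NormedSpace ℝ E] {P : Set E}
    (hP : Convex ℝ P) {d k : E} {s : ℝ} (hs : 0 ≤ s) (hd : d ∈ P) (hk : k ∈ P) :
    ∃ k' ∈ P, ∃ s' : ℝ, 0 ≤ s' ∧ d + s • k = s' • k' := by
  have h : 0 < 1 + s := by linarith
  refine ⟨(1 / (1 + s)) • d + (s / (1 + s)) • k,
    hP hd hk (by positivity) (by positivity) (by field_simp), 1 + s, h.le, ?_⟩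
  rw [smul_add, smul_smul, smul_smul, mul_div_cancel₀ _ h.ne', mul_div_cancel₀ _ h.ne', one_smul]

/-- Taking `t = (ρ - 1) / lam` in `hD` yields dilations by every `ρ` within `|lam|` of 1, hence the
ray condition. A positive ratio is then scaled away. -/
theorem inter_eq_cones_of_homothetic {E : Type*} [NormedAddCommGroup E] [NormedSpace ℝ E]
    {P N : Set E} (hP : Convex ℝ P) (hN : Convex ℝ N) (cP : IsClosed P) (cN : IsClosed N) {u : E}
    {lam : ℝ} (hlam : lam ≠ 0) (hlam1 : |lam| ≤ 1)
    (hbdd : Bornology.IsBounded {d | d ∈ P ∧ d - u ∈ N}) (hne : {d | d ∈ P ∧ d - u ∈ N}.Nonempty)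
    (hD : ∀ t ∈ Icc (-1 : ℝ) 1, ∀ y, (y ∈ P ∧ y - (1 + lam * t) • u ∈ N) ↔
      ∃ d, (d ∈ P ∧ d - u ∈ N) ∧ y = (1 + lam * t) • d)
    {t : ℝ} (ht : t ∈ Icc (-1 : ℝ) 1) {y k m : E} {s s' : ℝ} (hk : k ∈ P) (hm : m ∈ N)
    (hs : 0 ≤ s) (hs' : 0 ≤ s') (hy : y = s • k) (hyu : y - (1 + lam * t) • u = s' • m) :
    y ∈ P ∧ y - (1 + lam * t) • u ∈ N := by
  obtain ⟨c, hcP, hcN⟩ := hne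
  have key : ∀ {x k m : E} {s s' : ℝ}, k ∈ P → m ∈ N → 0 ≤ s → 0 ≤ s' → x = s • k →
      x - u = s' • m → x ∈ P ∧ x - u ∈ N := by
    intro x k m s s' hk hm hs hs' hx hxu
    refine mem_of_mem_cones hP hN cP cN (abs_pos.2 hlam) ?_ hcP hcN hk hm hs hs' hx hxu
    intro d hdP hdN ρ hρ
    have e : 1 + lam * ((ρ - 1) / lam) = ρ := by field_simp; ring
    have := (hD ((ρ - 1) / lam) (by
      rw [mem_Icc, ← abs_le, abs_div]
      exact div_le_one_of_le₀ hρ (abs_nonneg _)) (ρ • d)).2 ⟨d, ⟨hdP, hdN⟩, by rw [e]⟩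
    rw [e, ← smul_sub] at this
    exact this
  have hr0 : 0 ≤ 1 + lam * t := by
    have : |lam * t| ≤ 1 := by
      rw [abs_mul]
      exact mul_le_one₀ hlam1 (abs_nonneg _) (abs_le.2 ht)
    linarith [(abs_le.1 this).1]
  rw [hD t ht]
  set r := 1 + lam * t with hr
  rcases hr0.eq_or_lt with h | h
  -- At ratio 0 the point `y` lies in both cones with vertex 0, so adding it preserves the bounded
  -- intersection, which forces `y = 0`.
  · rw [← h, zero_smul, sub_zero] at hyu
    have hy0 : y = 0 := by
      refine eq_zero_of_isBounded_of_add_mem hbdd ⟨c, hcP, hcN⟩ ?_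
      rintro d ⟨hdP, hdN⟩
      obtain ⟨k', hk', σ, hσ, e⟩ := hP.exists_smul_eq_add hs hdP hk
      obtain ⟨m', hm', σ', hσ', e'⟩ := hN.exists_smul_eq_add hs' hdN hm
      refine key hk' hm' hσ hσ' ?_ ?_
      · rw [hy, e]
      · rw [hyu, ← e']; abel
    exact ⟨c, ⟨hcP, hcN⟩, by rw [← h, zero_smul, hy0]⟩
  · refine ⟨r⁻¹ • y, key hk hm (s := r⁻¹ * s) (s' := r⁻¹ * s') (by positivity) (by positivity)
      ?_ ?_, by rw [smul_inv_smul₀ h.ne']⟩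
    · rw [hy, mul_smul]
    · rw [mul_smul, ← hyu, smul_sub, inv_smul_smul₀ h.ne']

end Cones

/-! ### Application to the cross covariogram. -/

theorem mem_translateBy {n : ℕ} {A : Set (EuclideanSpace ℝ (Fin n))}
    {x y : EuclideanSpace ℝ (Fin n)} : y ∈ translateBy A x ↔ y - x ∈ A := by
  constructor
  · rintro ⟨z, hz, rfl⟩
    simpa using hz
  · intro h
    exact ⟨y - x, h, sub_add_cancel _ _⟩

theorem subset_coneFrom {n : ℕ} (p : EuclideanSpace ℝ (Fin n))
    (A : Set (EuclideanSpace ℝ (Fin n))) : A ⊆ coneFrom p A :=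
  fun x hx => ⟨x, hx, 1, zero_le_one, by simp⟩

theorem exists_homothetic_inter_translateBy (n : ℕ) (K L : Set (EuclideanSpace ℝ (Fin n)))
    (hKclosed : IsClosed K) (hKconvex : Convex ℝ K)
    (hLclosed : IsClosed L) (hLconvex : Convex ℝ L)
    (a w : EuclideanSpace ℝ (Fin n)) (hw : w ≠ 0) (β : ℝ) (hβ : β ≠ 0)
    (haffine : ∀ t ∈ Set.Icc (-1 : ℝ) 1,
      (crossCovariogram K L (a + t • w)).toReal ^ (1 / (n : ℝ)) =
        (crossCovariogram K L a).toReal ^ (1 / (n : ℝ)) + t * β) :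
    ∃ f : ℝ, |β| ≤ f ∧ Bornology.IsBounded (K ∩ translateBy L a) ∧
      (K ∩ translateBy L a).Nonempty ∧
      ∃ v, ∀ t ∈ Set.Icc (-1 : ℝ) 1, ∀ x, x ∈ K ∩ translateBy L (a + t • w) ↔
        ∃ c ∈ K ∩ translateBy L a, x = (1 + β / f * t) • c + t • v := by
  have hn : n ≠ 0 := by
    rintro rfl
    exact hw (Subsingleton.elim _ _)
  set f := (crossCovariogram K L a).toReal ^ (1 / (n : ℝ)) with hf
  have hnonneg : ∀ t ∈ Set.Icc (-1 : ℝ) 1, 0 ≤ f + t * β := fun t ht => by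
    rw [← haffine t ht]; positivity
  -- An n-th root is nonnegative, in particular at `t = ±1`.
  have hβf : |β| ≤ f := by
    rw [abs_le]
    constructor
    · linarith [hnonneg 1 (by norm_num)]
    · linarith [hnonneg (-1) (by norm_num)]
  have hvol : ∀ t ∈ Set.Icc (-1 : ℝ) 1, 0 < f + t * β →
      MeasureTheory.volume (K ∩ translateBy L (a + t • w)) = ENNReal.ofReal ((f + t * β) ^ n) := by
    intro t ht hp
    have h := haffine t ht
    have hpow : (crossCovariogram K L (a + t • w)).toReal = (f + t * β) ^ n := by
      rw [← h, ← Real.rpow_natCast, ← Real.rpow_mul ENNReal.toReal_nonneg,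
        one_div_mul_cancel (by exact_mod_cast hn), Real.rpow_one]
    rw [← hpow, ENNReal.ofReal_toReal]
    · rfl
    -- Infinite volume has `toReal` equal to 0, contradicting the positive root.
    · intro htop
      rw [htop, ENNReal.toReal_top] at hpow
      exact (pow_pos hp n).ne hpow
  have hfpos : 0 < f := (abs_pos.2 hβ).trans_le hβf
  have v0 := hvol 0 (by norm_num) (by simpa using hfpos)
  rw [zero_smul, add_zero, zero_mul, add_zero] at v0
  have vne : MeasureTheory.volume (K ∩ translateBy L a) ≠ 0 := by
    rw [v0]; simpa using pow_pos hfpos n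
  have hgraph : ∀ (t : ℝ) (x : EuclideanSpace ℝ (Fin n)), x ∈ K ∩ translateBy L (a + t • w) ↔ x ∈ K ∧ x - (a + t • w) ∈ L :=
    fun _ _ => and_congr_right fun _ => mem_translateBy
  have hclosed : IsClosed {p : ℝ × EuclideanSpace ℝ (Fin n) |
      p.2 ∈ K ∩ translateBy L (a + p.1 • w)} := by
    simp only [hgraph]
    exact (hKclosed.preimage continuous_snd).inter (hLclosed.preimage
      (f := fun p : ℝ × EuclideanSpace ℝ (Fin n) => p.2 - (a + p.1 • w)) (by fun_prop))
  have hconv : Convex ℝ {p : ℝ × EuclideanSpace ℝ (Fin n) |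
      p.2 ∈ K ∩ translateBy L (a + p.1 • w)} := by
    simp only [hgraph]
    rintro p ⟨hp1, hp2⟩ q ⟨hq1, hq2⟩ r s hr hs hrs
    refine ⟨hKconvex hp1 hq1 hr hs hrs, ?_⟩
    have := hLconvex hp2 hq2 hr hs hrs
    convert this using 1
    obtain rfl : r = 1 - s := by linarith
    simp only [Prod.fst_add, Prod.snd_add, Prod.smul_fst, Prod.smul_snd, smul_eq_mul]
    module
  obtain ⟨v, hv⟩ := exists_homothetic_family (C := fun t => K ∩ translateBy L (a + t • w))
    hclosed hconv hβ hβf hvol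
  refine ⟨f, hβf, ?_, MeasureTheory.nonempty_of_measure_ne_zero vne, v, ?_⟩
  · refine Convex.isBounded_of_volume_ne_top ?_ vne (by rw [v0]; exact ENNReal.ofReal_ne_top)
    intro x hx y hy r s hr hs hrs
    have h0 : ∀ x, x ∈ K ∩ translateBy L a ↔ x ∈ K ∧ x - a ∈ L := fun x =>
      and_congr_right fun _ => mem_translateBy
    rw [h0] at hx hy ⊢
    refine ⟨hKconvex hx.1 hy.1 hr hs hrs, ?_⟩
    have := hLconvex hx.2 hy.2 hr hs hrs
    convert this using 1
    obtain rfl : r = 1 - s := by linarith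
    module
  · simpa using hv

theorem theorem3 (n : ℕ) (K L : Set (EuclideanSpace ℝ (Fin n)))
    (hKclosed : IsClosed K) (hKconvex : Convex ℝ K)
    (hLclosed : IsClosed L) (hLconvex : Convex ℝ L)
    (hproper : ∃ b, 0 < crossCovariogram K L b ∧ crossCovariogram K L b < ∞)
    (a w : EuclideanSpace ℝ (Fin n)) (hw : w ≠ 0) (β : ℝ) (hβ : β ≠ 0)
    (haffine : ∀ t ∈ Set.Icc (-1 : ℝ) 1,
      (crossCovariogram K L (a + t • w)).toReal ^ (1 / (n : ℝ)) =
        (crossCovariogram K L a).toReal ^ (1 / (n : ℝ)) + t * β) :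
    ∃ (v : EuclideanSpace ℝ (Fin n)) (lam : ℝ),
      (0 < β → lam ∈ Set.Ioc (0 : ℝ) 1) ∧
      (β < 0 → lam ∈ Set.Ico (-1 : ℝ) 0) ∧
      ∀ t ∈ Set.Icc (-1 : ℝ) 1,
        K ∩ translateBy L (a + t • w) =
          coneFrom (-((1 / lam) • v)) K ∩
            translateBy (coneFrom (-((1 / lam) • (v - w))) (translateBy L a)) (t • w) := by
  obtain ⟨f, hβf, hbdd, hne, v, hv⟩ := exists_homothetic_inter_translateBy n K L hKclosed hKconvex
    hLclosed hLconvex a w hw β hβ haffine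
  have hf : 0 < f := (abs_pos.2 hβ).trans_le hβf
  set lam := β / f with hlam
  have hlam0 : lam ≠ 0 := div_ne_zero hβ hf.ne'
  have hlam1 : |lam| ≤ 1 := by
    rw [hlam, abs_div, abs_of_pos hf]
    exact div_le_one_of_le₀ hβf hf.le
  refine ⟨v, lam, fun h => ⟨div_pos h hf, (abs_le.1 hlam1).2⟩,
    fun h => ⟨(abs_le.1 hlam1).1, div_neg_of_neg_of_pos h hf⟩, fun t ht => ?_⟩
  -- `p` is fixed by every map `x ↦ (1 + lam t) x + t v`. Since `q = p + u` and `w = lam u`, the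
  -- moving vertex `q + t w` is `p + (1 + lam t) u`: seen from `p`, it dilates along with the
  -- sections.
  set p := -((1 / lam) • v) with hp
  set q := -((1 / lam) • (v - w)) with hq
  set u := (1 / lam) • w with hu
  have hpq : ∀ t : ℝ, ∀ y, q + (y - (1 + lam * t) • u) = p + y - t • w := by
    intro t y
    have : (1 + lam * t) • u = (1 / lam) • w + t • w := by
      rw [hu, smul_smul, ← add_smul]
      congr 1
      field_simp
    rw [this, hp, hq]
    module
  set P : Set (EuclideanSpace ℝ (Fin n)) := {y | p + y ∈ K} with hPdef
  set N : Set (EuclideanSpace ℝ (Fin n)) := {y | q + y - a ∈ L} with hNdef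
  have hmem : ∀ t y, p + y ∈ K ∩ translateBy L (a + t • w) ↔
      y ∈ P ∧ y - (1 + lam * t) • u ∈ N := by
    intro t y
    refine and_congr_right fun _ => ?_
    rw [mem_translateBy]
    change _ ↔ q + (y - (1 + lam * t) • u) - a ∈ L
    rw [hpq, sub_sub, add_comm a]
  have hmem0 : ∀ y, p + y ∈ K ∩ translateBy L a ↔ y ∈ P ∧ y - u ∈ N := by
    intro y
    simpa using hmem 0 y
  apply Set.Subset.antisymm
  · rintro x ⟨hxK, hxL⟩
    refine ⟨subset_coneFrom _ _ hxK, ?_⟩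
    rw [mem_translateBy] at hxL ⊢
    refine subset_coneFrom _ _ (mem_translateBy.2 ?_)
    convert hxL using 1
    abel
  · rintro x ⟨⟨k, hk, s, hs, hx⟩, hxL⟩
    rw [mem_translateBy] at hxL
    obtain ⟨m, hm, s', hs', hxm⟩ := hxL
    rw [mem_translateBy] at hm
    have hlamv : lam • p = -v := by
      rw [hp, smul_neg, smul_smul, mul_one_div_cancel hlam0, one_smul]
    have key := inter_eq_cones_of_homothetic (P := P) (N := N) (u := u)
      (by
        intro x hx y hy r s hr hs hrs
        have := hKconvex hx hy hr hs hrs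
        change p + _ ∈ K
        convert this using 1
        obtain rfl : r = 1 - s := by linarith
        module)
      (by
        intro x hx y hy r s hr hs hrs
        have := hLconvex hx hy hr hs hrs
        change q + _ - a ∈ L
        convert this using 1
        obtain rfl : r = 1 - s := by linarith
        module)
      (hKclosed.preimage (f := fun y => p + y) (by fun_prop))
      (hLclosed.preimage (f := fun y => q + y - a) (by fun_prop))
      hlam0 hlam1
      (by
        obtain ⟨R, hR⟩ := hbdd.exists_norm_le
        refine (isBounded_iff_forall_norm_le).2 ⟨R + ‖p‖, fun d hd => ?_⟩
        have h1 := hR _ ((hmem0 d).2 hd)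
        have h2 := norm_sub_le (p + d) p
        rw [add_sub_cancel_left] at h2
        linarith)
      (by
        obtain ⟨c, hc⟩ := hne
        exact ⟨c - p, (hmem0 _).1 (by rwa [add_sub_cancel])⟩)
      (by
        intro t ht y
        rw [← hmem, hv t ht]
        have hshift : ∀ d, (1 + lam * t) • (p + d) + t • v = p + (1 + lam * t) • d := by
          intro d
          have : v = -(lam • p) := by rw [hlamv, neg_neg]
          rw [this]
          module
        constructor
        · rintro ⟨c, hc, hy⟩
          refine ⟨c - p, (hmem0 _).1 (by rwa [add_sub_cancel]), ?_⟩
          rw [← add_right_inj p, hy, ← hshift, add_sub_cancel]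
        · rintro ⟨d, hd, rfl⟩
          exact ⟨p + d, (hmem0 d).2 hd, (hshift d).symm⟩)
      ht (y := x - p) (k := k - p) (m := m - q) (s := s) (s' := s')
      (by change p + (k - p) ∈ K; rwa [add_sub_cancel])
      (by change q + (m - q) - a ∈ L; rwa [add_sub_cancel])
      hs hs' (by rw [hx]; abel)
      (by rw [← add_right_inj q, hpq, add_sub_cancel, hxm])
    have := (hmem t _).2 key
    rwa [add_sub_cancel] at this
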